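/- Let $G$ be a finite simple graph with vertex set $V$, and let $\mathcal S(G)$ be the set of real symmetric matrices $A$ indexed by $V$ such that, for $i\ne j$, $A_{ij}\ne 0$ if and only if $\{i,j\}\in E(G)$ (the diagonal is unconstrained). For a set $\beta$ of edges of the complement $\overline G$, let $G+\beta$ be the graph on $V$ with edge set $E(G)\cup\beta$. A real symmetric matrix $A$ has the SSP (respectively, the SAP) if $X=O$ is the only real symmetric matrix with $A\circ X=O$, $I\circ X=O$ and $AX-XA=O$ (respectively, $AX=O$), where $\circ$ is the entrywise product. For $A\in\mathcal S(G)$ and a graph $H$ on $V$ with $E(G)\subseteq E(H)$, $A$ has the SSP (respectively, the SAP) with respect to $H$ if $X=O$ is the only real symmetric matrix that has zero diagonal, satisfies $X_{ij}=0$ for every $\{i,j\}\in E(H)$, and satisfies $AX-XA=O$ (respectively, $AX=O$). A nonempty set $\beta\subseteq E(\overline G)$ is an SSP (respectively, SAP) liberation set of $A\in\mathcal S(G)$ if $A$ has the SSP (respectively, the SAP) with respect to $G+\beta'$ for every $\beta'\subset\beta$ with $|\beta'|=|\beta|-1$. **Lemma (Matrix Liberation Lemma, set version).** Let $A\in\mathcal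 S(G)$. 1. If $\beta$ is an SSP liberation set of $A$, then there is a matrix $A'\in\mathcal S(G+\beta)$ that has the SSP and satisfies $\operatorname{spec}(A')=\operatorname{spec}(A)$, where $\operatorname{spec}$ denotes the multiset of eigenvalues, counted with multiplicity. 2. If $\beta$ is an SAP liberation set of $A$, then there is a matrix $A'\in\mathcal S(G+\beta)$ that has the SAP and satisfies $\operatorname{rank}(A')=\operatorname{rank}(A)$. -/

import Mathlib

open scoped Matrix

/-- `𝒮(G)`: real symmetric matrices whose off-diagonal `(i, j)` entry is nonzero exactly when
`{i, j}` is an edge of `G`; the diagonal is unconstrained. -/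
def graphMatrices {V : Type*} (G : SimpleGraph V) : Set (Matrix V V ℝ) :=
  {A | A.IsSymm ∧ ∀ i j, i ≠ j → (A i j ≠ 0 ↔ G.Adj i j)}

/-- `𝒮₀ᶜˡ(G)`: real symmetric matrices with zero diagonal whose off-diagonal `(i, j)` entry
may be nonzero only when `{i, j}` is an edge of `G`. -/
def graphMatricesClosedZero {V : Type*} (G : SimpleGraph V) : Set (Matrix V V ℝ) :=
  {X | X.IsSymm ∧ (∀ i, X i i = 0) ∧ ∀ i j, i ≠ j → ¬ G.Adj i j → X i j = 0}

/-- The graph `G + β` obtained from `G` by adding the edges in `β`. -/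
def addEdges {V : Type*} (G : SimpleGraph V) (β : Finset (Sym2 V)) : SimpleGraph V :=
  G ⊔ SimpleGraph.fromEdgeSet (β : Set (Sym2 V))

section StrongProperties

variable {V : Type*} [Fintype V] [DecidableEq V]

/-- The strong spectral property of a (symmetric) matrix `A`. Here `⊙` is the entrywise product
and `⁅A, X⁆ = A * X - X * A`. -/
def HasSSP (A : Matrix V V ℝ) : Prop :=
  ∀ X : Matrix V V ℝ, X.IsSymm → A ⊙ X = 0 → (1 : Matrix V V ℝ) ⊙ X = 0 → ⁅A, X⁆ = 0 → X = 0

/-- The strong Arnold property of a (symmetric) matrix `A`. -/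
def HasSAP (A : Matrix V V ℝ) : Prop :=
  ∀ X : Matrix V V ℝ, X.IsSymm → A ⊙ X = 0 → (1 : Matrix V V ℝ) ⊙ X = 0 → A * X = 0 → X = 0

/-- The matrix `A` has the SSP with respect to the graph `H`. -/
def HasSSPWrt (A : Matrix V V ℝ) (H : SimpleGraph V) : Prop :=
  ∀ X ∈ graphMatricesClosedZero Hᶜ, ⁅A, X⁆ = 0 → X = 0

/-- The matrix `A` has the SAP with respect to the graph `H`. -/
def HasSAPWrt (A : Matrix V V ℝ) (H : SimpleGraph V) : Prop :=
  ∀ X ∈ graphMatricesClosedZero Hᶜ, A * X = 0 → X = 0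

/-- `β` is an SSP liberation set of `A ∈ 𝒮(G)`: a nonempty set of non-edges of `G` such that `A`
has the SSP with respect to `G + β'` for every `β' ⊂ β` with `|β'| = |β| - 1`. -/
def IsSSPLiberationSet (G : SimpleGraph V) (A : Matrix V V ℝ) (β : Finset (Sym2 V)) : Prop :=
  β.Nonempty ∧ (β : Set (Sym2 V)) ⊆ Gᶜ.edgeSet ∧
    ∀ β' : Finset (Sym2 V), β' ⊂ β → β'.card + 1 = β.card → HasSSPWrt A (addEdges G β')

/-- `β` is an SAP liberation set of `A ∈ 𝒮(G)`: a nonempty set of non-edges of `G` such that `A`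
has the SAP with respect to `G + β'` for every `β' ⊂ β` with `|β'| = |β| - 1`. -/
def IsSAPLiberationSet (G : SimpleGraph V) (A : Matrix V V ℝ) (β : Finset (Sym2 V)) : Prop :=
  β.Nonempty ∧ (β : Set (Sym2 V)) ⊆ Gᶜ.edgeSet ∧
    ∀ β' : Finset (Sym2 V), β' ⊂ β → β'.card + 1 = β.card → HasSAPWrt A (addEdges G β')

/-- The spectrum of a real symmetric matrix as a multiset: the eigenvalues repeated according to
their multiplicities, i.e. the roots of the characteristic polynomial (all of which are real, and
whose algebraic and geometric multiplicities agree, because the matrix is symmetric). -/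
noncomputable def matrixSpec (A : Matrix V V ℝ) : Multiset ℝ :=
  A.charpoly.roots

end StrongProperties

open scoped Matrix.Norms.Operator Topology
open Filter Matrix NormedSpace

/-! Move `A` along its orbit under `K ↦ exp K * A * (exp K)ᵀ`, with `K` skew for the SSP (spectrum
fixed) and arbitrary for the SAP (rank fixed). The tangent vectors at `A` are `K * A + A * Kᵀ`, and
a symmetric `X` that is trace-orthogonal to all of them satisfies `⁅A, X⁆ = 0`, respectively `A * X
= 0`. By duality, a strong property with respect to `H` makes the tangent space project onto the
entries at non-edges of `H`. Taking `H = G + (β - e)` gives a tangent direction that vanishes on the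
non-edges of `G + β` but not at `e`. A real vector space is not a finite union of proper subspaces,
so one direction serves every `e ∈ β`. The implicit function theorem integrates it to a curve in the
orbit that stays zero off `G + β`. At small `t ≠ 0` the entries on `β` have become nonzero, those on
`G` are still nonzero, and the strong property with respect to `G + β` persists by openness. -/

/-- A strictly differentiable map with surjective derivative is constant along some curve through
the base point with any prescribed velocity in the kernel of the derivative. -/
theorem HasStrictFDerivAt.exists_curve {E F : Type*} [NormedAddCommGroup E] [NormedSpace ℝ E]
    [CompleteSpace E] [NormedAddCommGroup F] [NormedSpace ℝ F] [FiniteDimensional ℝ F]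
    {f : E → F} {f' : E →L[ℝ] F} {a : E} (hf : HasStrictFDerivAt f f' a)
    (hf' : f'.range = ⊤) {v : E} (hv : f' v = 0) :
    ∃ γ : ℝ → E, γ 0 = a ∧ HasDerivAt γ v 0 ∧ ∀ᶠ t in 𝓝 0, f (γ t) = f a := by
  have : CompleteSpace F := FiniteDimensional.complete ℝ F
  let w : f'.ker := ⟨v, hv⟩
  have hline : HasDerivAt (fun t : ℝ => t • w) w 0 := by
    simpa using (hasDerivAt_id (0 : ℝ)).smul_const w
  have hz : (fun t : ℝ => t • w) 0 = 0 := by simp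
  -- The implicit function parametrizes the level set by the kernel, with derivative the inclusion
  -- at `0`, so the line `t • w` maps to a curve of velocity `v`.
  refine ⟨fun t => hf.implicitFunction f f' hf' (f a) (t • w), ?_, ?_, ?_⟩
  · simp
  · have h := (hf.to_implicitFunction hf').hasFDerivAt
    rw [← hz] at h
    exact h.comp_hasDerivAt (0 : ℝ) hline
  · have h := hf.map_implicitFunction_eq hf'
    have ht : Tendsto (fun t : ℝ => (f a, t • w)) (𝓝 0) (𝓝 (f a, (0 : f'.ker))) := by
      have hc : Continuous (fun t : ℝ => (f a, t • w)) := by fun_prop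
      simpa using hc.tendsto 0
    exact ht.eventually h

/-- In a linear family of linear maps between finite-dimensional spaces, injectivity is an open
condition on the parameter. -/
theorem LinearMap.eventually_injective {E F F' : Type*}
    [NormedAddCommGroup E] [NormedSpace ℝ E] [FiniteDimensional ℝ E]
    [NormedAddCommGroup F] [NormedSpace ℝ F] [FiniteDimensional ℝ F]
    [NormedAddCommGroup F'] [NormedSpace ℝ F']
    (Φ : E →ₗ[ℝ] F →ₗ[ℝ] F') {a : E} (h : Function.Injective (Φ a)) :
    ∀ᶠ b in 𝓝 a, Function.Injective (Φ b) := by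
  have hcont : Continuous (LinearMap.toContinuousLinearMap.toLinearMap ∘ₗ Φ) :=
    LinearMap.continuous_of_finiteDimensional _
  exact hcont.continuousAt.eventually_mem (ContinuousLinearMap.isOpen_injective.mem_nhds h)

section Liberation

variable {V : Type*}

/-! ### Matrices supported on the edges of a graph -/

/-- `graphMatricesClosedZero H` as a subspace. -/
def closedZeroSubmodule (H : SimpleGraph V) : Submodule ℝ (Matrix V V ℝ) where
  carrier := graphMatricesClosedZero H
  zero_mem' := ⟨Matrix.isSymm_zero, fun _ => rfl, fun _ _ _ _ => rfl⟩
  add_mem' := by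
    rintro X Y ⟨hX, hX0, hX1⟩ ⟨hY, hY0, hY1⟩
    refine ⟨hX.add hY, fun i => by simp [hX0, hY0], fun i j hij h => ?_⟩
    simp [hX1 i j hij h, hY1 i j hij h]
  smul_mem' := by
    rintro c X ⟨hX, hX0, hX1⟩
    refine ⟨hX.smul c, fun i => by simp [hX0], fun i j hij h => ?_⟩
    simp [hX1 i j hij h]

theorem apply_eq_zero_of_mem_closedZeroSubmodule {H : SimpleGraph V} {X : Matrix V V ℝ}
    (hX : X ∈ closedZeroSubmodule H) {i j : V} (h : ¬ H.Adj i j) : X i j = 0 := by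
  by_cases hij : i = j
  · subst hij; exact hX.2.1 i
  · exact hX.2.2 i j hij h

open Classical in
/-- The symmetrized restriction of a matrix to the edges of `H`. -/
noncomputable def edgeProj (H : SimpleGraph V) :
    Matrix V V ℝ →ₗ[ℝ] closedZeroSubmodule H where
  -- Averaging allows non-symmetric arguments such as matrix units; on symmetric matrices this is
  -- plain restriction.
  toFun M := ⟨Matrix.of fun i j => if H.Adj i j then (M i j + M j i) / 2 else 0, by
    refine ⟨?_, fun i => by simp, fun i j _ h => by simp [h]⟩
    ext i j
    simp [H.adj_comm i j, add_comm]⟩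
  map_add' M N := by
    ext i j
    by_cases h : H.Adj i j <;> simp [h]
    ring
  map_smul' c M := by
    ext i j
    by_cases h : H.Adj i j <;> simp [h]
    ring

theorem edgeProj_apply_of_adj {H : SimpleGraph V} {M : Matrix V V ℝ} {i j : V}
    (h : H.Adj i j) : (edgeProj H M : Matrix V V ℝ) i j = (M i j + M j i) / 2 := by
  simp [edgeProj, h]

theorem edgeProj_apply_of_adj_of_isSymm {H : SimpleGraph V} {M : Matrix V V ℝ} (hM : M.IsSymm)
    {i j : V} (h : H.Adj i j) : (edgeProj H M : Matrix V V ℝ) i j = M i j := by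
  rw [edgeProj_apply_of_adj h, hM.apply i j]; ring

theorem edgeProj_eq_self {H : SimpleGraph V} (X : closedZeroSubmodule H) :
    edgeProj H (X : Matrix V V ℝ) = X := by
  ext i j
  by_cases h : H.Adj i j
  · exact edgeProj_apply_of_adj_of_isSymm X.2.1 h
  · rw [apply_eq_zero_of_mem_closedZeroSubmodule (edgeProj H _).2 h,
      apply_eq_zero_of_mem_closedZeroSubmodule X.2 h]

theorem edgeProj_eq_zero_iff {H : SimpleGraph V} {M : Matrix V V ℝ} (hM : M.IsSymm) :
    edgeProj H M = 0 ↔ ∀ i j, H.Adj i j → M i j = 0 := by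
  constructor
  · intro h i j hij
    rw [← edgeProj_apply_of_adj_of_isSymm hM hij, h]; rfl
  · intro h
    ext i j
    by_cases hij : H.Adj i j
    · rw [edgeProj_apply_of_adj_of_isSymm hM hij, h i j hij]; rfl
    · exact apply_eq_zero_of_mem_closedZeroSubmodule (edgeProj H _).2 hij

theorem addEdges_adj {G : SimpleGraph V} {β : Finset (Sym2 V)} {i j : V} :
    (addEdges G β).Adj i j ↔ G.Adj i j ∨ (s(i, j) ∈ β ∧ i ≠ j) := by
  simp [addEdges]

/-- More edges leave fewer test matrices, so a strong property with respect to `G + β'` passes to `G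
+ β`. -/
theorem graphMatricesClosedZero_compl_anti (G : SimpleGraph V) {β' β : Finset (Sym2 V)}
    (hβ : β' ⊆ β) :
    graphMatricesClosedZero (addEdges G β)ᶜ ⊆ graphMatricesClosedZero (addEdges G β')ᶜ := by
  refine fun X hX => ⟨hX.1, hX.2.1, fun i j hij hn => hX.2.2 i j hij fun h => hn ?_⟩
  simp only [SimpleGraph.compl_adj, addEdges_adj] at h ⊢
  have := @hβ s(i, j)
  tauto

/-- Skew-symmetric matrices. -/
def skewSubmodule (V : Type*) : Submodule ℝ (Matrix V V ℝ) where
  carrier := {K | Kᵀ = -K}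
  zero_mem' := by simp
  add_mem' := by
    intro K L hK hL
    simp only [Set.mem_ofPred_eq] at *
    rw [Matrix.transpose_add, hK, hL, neg_add]
  smul_mem' := by
    intro c K hK
    simp only [Set.mem_ofPred_eq] at *
    rw [Matrix.transpose_smul, hK, smul_neg]

theorem eq_zero_of_trace_mul_transpose [Fintype V] {M : Matrix V V ℝ} (h : (M * Mᵀ).trace = 0) : M = 0 := by
  rw [← Matrix.conjTranspose_eq_transpose_of_trivial] at h
  exact Matrix.trace_mul_conjTranspose_self_eq_zero_iff.1 h

theorem mem_graphMatricesClosedZero_compl [DecidableEq V] {A X : Matrix V V ℝ} {H : SimpleGraph V}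
    (hA : A ∈ graphMatrices H) (hX : X.IsSymm) (hAX : A ⊙ X = 0)
    (hIX : (1 : Matrix V V ℝ) ⊙ X = 0) : X ∈ graphMatricesClosedZero Hᶜ := by
  refine ⟨hX, fun i => ?_, fun i j hij h => ?_⟩
  · simpa using congrFun (congrFun hIX i) i
  · have hadj : H.Adj i j := by
      by_contra hn
      exact h ((SimpleGraph.compl_adj _ _ _).2 ⟨hij, hn⟩)
    have := congrFun (congrFun hAX i) j
    exact (mul_eq_zero.1 this).resolve_left ((hA.2 i j hij).2 hadj)

variable [Fintype V] [DecidableEq V]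

/-! ### Trace duality and the tangent space of the orbit -/

/-- Every functional on the subspace of matrices supported on `H` is the trace pairing with a
matrix of that subspace. -/
theorem exists_trace_representation (H : SimpleGraph V)
    (φ : closedZeroSubmodule H →ₗ[ℝ] ℝ) :
    ∃ X ∈ closedZeroSubmodule H, ∀ M : Matrix V V ℝ, φ (edgeProj H M) = (X * M).trace := by
  have hswap : ∀ i j, edgeProj H (Matrix.single i j 1) = edgeProj H (Matrix.single j i 1) := by
    intro i j
    ext k l
    by_cases h : H.Adj k l
    · rw [edgeProj_apply_of_adj h, edgeProj_apply_of_adj h]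
      simp [Matrix.single_apply, and_comm, add_comm]
    · rw [apply_eq_zero_of_mem_closedZeroSubmodule (edgeProj H _).2 h,
        apply_eq_zero_of_mem_closedZeroSubmodule (edgeProj H _).2 h]
  have hzero : ∀ i j, ¬ H.Adj i j → edgeProj H (Matrix.single i j 1) = 0 := by
    intro i j hij
    ext k l
    by_cases h : H.Adj k l
    · rw [edgeProj_apply_of_adj h]
      have h1 : ¬ (i = k ∧ j = l) := by rintro ⟨rfl, rfl⟩; exact hij h
      have h2 : ¬ (i = l ∧ j = k) := by rintro ⟨rfl, rfl⟩; exact hij h.symm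
      simp [h1, h2]
    · exact apply_eq_zero_of_mem_closedZeroSubmodule (edgeProj H _).2 h
  refine ⟨Matrix.of fun i j => φ (edgeProj H (Matrix.single i j 1)), ⟨?_, ?_, ?_⟩, ?_⟩
  · ext i j
    simp [hswap i j]
  · intro i
    simp [hzero i i]
  · intro i j _ h
    simp [hzero i j h]
  · intro M
    conv_lhs => rw [Matrix.matrix_eq_sum_single M]
    simp only [map_sum, Matrix.trace, Matrix.diag, Matrix.mul_apply, Matrix.of_apply]
    rw [Finset.sum_comm]
    refine Finset.sum_congr rfl fun j _ => Finset.sum_congr rfl fun i _ => ?_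
    have : Matrix.single i j (M i j) = M i j • Matrix.single i j (1 : ℝ) := by simp
    rw [this, map_smul, map_smul, smul_eq_mul, mul_comm, hswap]

/-- The derivative at `0` of `K ↦ exp K * A * (exp K)ᵀ`. -/
noncomputable def congrDeriv (A : Matrix V V ℝ) : Matrix V V ℝ →ₗ[ℝ] Matrix V V ℝ where
  toFun K := K * A + A * Kᵀ
  map_add' K L := by simp [add_mul, mul_add]; abel
  map_smul' c K := by simp

theorem congrDeriv_apply (A K : Matrix V V ℝ) : congrDeriv A K = K * A + A * Kᵀ := rfl

theorem congrDeriv_isSymm {A : Matrix V V ℝ} (hA : A.IsSymm) (K : Matrix V V ℝ) :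
    (congrDeriv A K).IsSymm := by
  simp [Matrix.IsSymm, congrDeriv_apply, hA.eq, add_comm]

theorem hasStrictFDerivAt_exp_congr (A : Matrix V V ℝ) :
    HasStrictFDerivAt (fun K : Matrix V V ℝ => exp K * A * (exp K)ᵀ)
      (LinearMap.toContinuousLinearMap (congrDeriv A)) 0 := by
  have h1 : HasStrictFDerivAt (exp : Matrix V V ℝ → Matrix V V ℝ)
      (1 : Matrix V V ℝ →L[ℝ] Matrix V V ℝ) 0 := hasStrictFDerivAt_exp_zero
  let T : Matrix V V ℝ →L[ℝ] Matrix V V ℝ := LinearMap.toContinuousLinearMap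
    (Matrix.transposeLinearEquiv V V ℝ ℝ).toLinearMap
  have h2 : HasStrictFDerivAt (fun K : Matrix V V ℝ => (exp K)ᵀ) (T.comp 1) 0 :=
    T.hasStrictFDerivAt.comp 0 h1
  have h3 := (h1.mul_const' A).mul' h2
  refine h3.congr_fderiv ?_
  ext1 K
  change exp 0 * A * Kᵀ + K * A * (exp 0)ᵀ = K * A + A * Kᵀ
  simp [add_comm]

/-- If the trace pairing with the tangent space detects every matrix supported on `H`, then the
projection of the tangent space to the edges of `H` is onto. -/
theorem edgeProj_comp_congrDeriv_range (H : SimpleGraph V) (A : Matrix V V ℝ)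
    (W : Submodule ℝ (Matrix V V ℝ))
    (h : ∀ X ∈ graphMatricesClosedZero H,
      (∀ K ∈ W, (X * congrDeriv A K).trace = 0) → X = 0) :
    (edgeProj H ∘ₗ congrDeriv A ∘ₗ W.subtype).range = ⊤ := by
  by_contra hne
  -- A proper subspace is killed by some nonzero functional; its representing matrix is orthogonal
  -- to the tangent space, hence zero.
  obtain ⟨φ, hφ, hle⟩ := Submodule.exists_le_ker_of_lt_top _ (lt_top_iff_ne_top.2 hne)
  obtain ⟨X, hX, hXφ⟩ := exists_trace_representation H φ
  have hX0 : X = 0 := by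
    refine h X hX fun K hK => ?_
    rw [← hXφ]
    exact hle ⟨⟨K, hK⟩, rfl⟩
  apply hφ
  ext Y
  rw [← edgeProj_eq_self Y, hXφ, hX0]
  simp

/-! ### Perturbation along the orbit -/

/-- The perturbation argument common to both parts of the Matrix Liberation Lemma. -/
theorem exists_congr_mem_graphMatrices (G : SimpleGraph V) (A : Matrix V V ℝ)
    (hA : A ∈ graphMatrices G) (β : Finset (Sym2 V)) (hβ : β.Nonempty)
    (hG : (β : Set (Sym2 V)) ⊆ Gᶜ.edgeSet) (W : Submodule ℝ (Matrix V V ℝ))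
    (h : ∀ e ∈ β, ∀ X ∈ graphMatricesClosedZero (addEdges G (β.erase e))ᶜ,
      (∀ K ∈ W, (X * congrDeriv A K).trace = 0) → X = 0)
    {U : Set (Matrix V V ℝ)} (hU : U ∈ 𝓝 A) :
    ∃ K ∈ W, exp K * A * (exp K)ᵀ ∈ graphMatrices (addEdges G β) ∧
      exp K * A * (exp K)ᵀ ∈ U := by
  have hmono : ∀ e, ∀ i j, (addEdges G β)ᶜ.Adj i j → (addEdges G (β.erase e))ᶜ.Adj i j := by
    intro e i j hij
    simp only [SimpleGraph.compl_adj, addEdges_adj, Finset.mem_erase] at hij ⊢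
    tauto
  set H := addEdges G β with hH
  have hrange : (edgeProj Hᶜ ∘ₗ congrDeriv A ∘ₗ W.subtype).range = ⊤ := by
    refine edgeProj_comp_congrDeriv_range _ _ _ fun X hX => ?_
    obtain ⟨e, he⟩ := hβ
    exact h e he X ⟨hX.1, hX.2.1, fun i j hij hn => hX.2.2 i j hij fun h' => hn (hmono e i j h')⟩
  have hedge : ∀ i j, s(i, j) ∈ β → i ≠ j ∧ ¬ G.Adj i j := by
    intro i j hij
    have := hG hij
    simpa using this
  -- a velocity vanishing off `H` and nonzero on every edge of `β`
  obtain ⟨v, hv0, hvβ⟩ : ∃ v ∈ LinearMap.ker (edgeProj Hᶜ ∘ₗ congrDeriv A ∘ₗ W.subtype),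
      ∀ p : {p : V × V // s(p.1, p.2) ∈ β},
        ((Matrix.entryLinearMap ℝ ℝ p.1.1 p.1.2) ∘ₗ congrDeriv A ∘ₗ W.subtype) v ≠ 0 := by
    -- Finitely many functionals, each nonzero somewhere on the kernel, are simultaneously nonzero
    -- at some point of it.
    refine Module.Dual.exists_forall_mem_ne_zero_of_forall_exists _
      (fun p : {p : V × V // s(p.1, p.2) ∈ β} =>
        (Matrix.entryLinearMap ℝ ℝ p.1.1 p.1.2) ∘ₗ congrDeriv A ∘ₗ W.subtype) ?_
    rintro ⟨⟨i, j⟩, hij⟩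
    simp only at hij
    have hadj : (addEdges G (β.erase s(i, j)))ᶜ.Adj i j := by
      simp [addEdges_adj, hedge i j hij]
    have hr := edgeProj_comp_congrDeriv_range _ A W (h s(i, j) hij)
    -- Prescribe the value 1 at the edge `s(i, j)` and 0 at every other non-edge of `G + (β - s(i,
    -- j))`.
    obtain ⟨K, hK⟩ := LinearMap.range_eq_top.1 hr
      (edgeProj _ (Matrix.single i j 1 + Matrix.single j i 1))
    have hval : ∀ k l, (addEdges G (β.erase s(i, j)))ᶜ.Adj k l →
        congrDeriv A (K : Matrix V V ℝ) k l =
          (Matrix.single i j (1 : ℝ) + Matrix.single j i 1 : Matrix V V ℝ) k l := by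
      intro k l hkl
      rw [← edgeProj_apply_of_adj_of_isSymm (congrDeriv_isSymm hA.1 _) hkl]
      have hs : (Matrix.single i j (1 : ℝ) + Matrix.single j i 1 : Matrix V V ℝ).IsSymm := by
        simp [Matrix.IsSymm, add_comm]
      rw [← edgeProj_apply_of_adj_of_isSymm hs hkl, ← hK]
      rfl
    refine ⟨K, ?_, ?_⟩
    · rw [LinearMap.mem_ker]
      refine (edgeProj_eq_zero_iff (congrDeriv_isSymm hA.1 _)).2 fun k l hkl => ?_
      refine (hval k l (hmono _ k l hkl)).trans ?_
      have hkl' : s(k, l) ∉ β := by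
        simp only [hH, SimpleGraph.compl_adj, addEdges_adj] at hkl
        tauto
      have h1 : ¬ (i = k ∧ j = l) := by rintro ⟨rfl, rfl⟩; exact hkl' hij
      have h2 : ¬ (j = k ∧ i = l) := by
        rintro ⟨rfl, rfl⟩; exact hkl' (Sym2.eq_swap ▸ hij)
      simp [h1, h2]
    · have hji : ¬ (j = i ∧ i = j) := fun h' => (hedge i j hij).1 h'.2
      change congrDeriv A (K : Matrix V V ℝ) i j ≠ 0
      rw [hval i j hadj]
      simp [hji]
  let F : W → Matrix V V ℝ := fun K => exp (K : Matrix V V ℝ) * A * (exp (K : Matrix V V ℝ))ᵀ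
  have hF0 : F 0 = A := by simp [F]
  have hFsymm : ∀ K, (F K).IsSymm := by
    intro K
    simp [F, Matrix.IsSymm, Matrix.mul_assoc, hA.1.eq]
  have hF : HasStrictFDerivAt F
      ((LinearMap.toContinuousLinearMap (congrDeriv A)).comp W.subtypeL) 0 := by
    have h1 := hasStrictFDerivAt_exp_congr A
    have h2 : HasStrictFDerivAt (fun K : W => (K : Matrix V V ℝ)) W.subtypeL 0 :=
      W.subtypeL.hasStrictFDerivAt
    exact HasStrictFDerivAt.comp (0 : W) (f := fun K : W => (K : Matrix V V ℝ)) h1 h2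
  let P := LinearMap.toContinuousLinearMap (edgeProj (V := V) Hᶜ)
  have hPF := P.hasStrictFDerivAt.comp (0 : W) hF
  obtain ⟨γ, hγ0, hγ, hγP⟩ := hPF.exists_curve (v := v) (by
    rw [← hrange]; rfl) hv0
  have hPA : P (F 0) = 0 := by
    rw [hF0]
    refine (edgeProj_eq_zero_iff hA.1).2 fun i j hij => ?_
    by_contra hne
    have : G.Adj i j := (hA.2 i j hij.ne).1 hne
    simp [hH, addEdges_adj, this] at hij
  have hFγ : HasDerivAt (fun t => F (γ t)) (congrDeriv A (v : Matrix V V ℝ)) 0 := by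
    have h1 := hF.hasFDerivAt
    rw [← hγ0] at h1
    exact h1.comp_hasDerivAt (0 : ℝ) hγ
  have hentry : ∀ i j, HasDerivAt (fun t => F (γ t) i j) (congrDeriv A (v : Matrix V V ℝ) i j) 0 := by
    intro i j
    exact (LinearMap.toContinuousLinearMap
      (Matrix.entryLinearMap ℝ ℝ i j)).hasFDerivAt.comp_hasDerivAt (0 : ℝ) hFγ
  have hβne : ∀ᶠ t in 𝓝[≠] (0 : ℝ), ∀ p : {p : V × V // s(p.1, p.2) ∈ β},
      F (γ t) p.1.1 p.1.2 ≠ 0 :=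
    eventually_all.2 fun p => (hentry p.1.1 p.1.2).eventually_ne (hvβ p)
  have hGne : ∀ᶠ t in 𝓝 (0 : ℝ), ∀ p : {p : V × V // G.Adj p.1 p.2},
      F (γ t) p.1.1 p.1.2 ≠ 0 := by
    refine eventually_all.2 fun p => (hentry p.1.1 p.1.2).continuousAt.eventually_ne ?_
    simp only [hγ0, hF0]
    exact (hA.2 _ _ p.2.ne).2 p.2
  have hUev : ∀ᶠ t in 𝓝 (0 : ℝ), F (γ t) ∈ U := by
    refine hFγ.continuousAt.eventually_mem ?_
    rw [hγ0, hF0]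
    exact hU
  -- The neighborhood is punctured because the entries on `β` vanish at `t = 0`; their nonzero
  -- derivatives make them nonzero nearby.
  obtain ⟨t, ht1, ht2, ht3, ht4⟩ := (hβne.and ((hGne.and (hUev.and hγP)).filter_mono
    nhdsWithin_le_nhds)).exists
  refine ⟨γ t, (γ t).2, ⟨hFsymm (γ t), fun i j hij => ⟨fun hne => ?_, fun hadj => ?_⟩⟩, ht3⟩
  · by_contra hnadj
    refine hne ((edgeProj_eq_zero_iff (hFsymm (γ t))).1 (ht4.trans hPA) i j ?_)
    exact (SimpleGraph.compl_adj _ _ _).2 ⟨hij, hnadj⟩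
  · rcases addEdges_adj.1 hadj with hG' | ⟨hβ', -⟩
    · exact ht2 ⟨(i, j), hG'⟩
    · exact ht1 ⟨(i, j), hβ'⟩

/-! ### Normal vectors to the orbit, and openness of the strong properties -/

/-- The commutator `C = ⁅A, X⁆` of symmetric matrices is skew, so `K = Cᵀ` is an admissible test
direction, and its pairing equals `(C * Cᵀ).trace`. -/
theorem lie_eq_zero_of_trace_eq_zero {A X : Matrix V V ℝ} (hA : A.IsSymm) (hX : X.IsSymm)
    (h : ∀ K ∈ skewSubmodule V, (X * congrDeriv A K).trace = 0) : ⁅A, X⁆ = 0 := by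
  have hskew : ⁅A, X⁆ᵀ = -⁅A, X⁆ := by
    simp [Ring.lie_def, hA.eq, hX.eq]
  apply eq_zero_of_trace_mul_transpose
  have h1 := h ⁅A, X⁆ᵀ (by
    change ⁅A, X⁆ᵀᵀ = -⁅A, X⁆ᵀ
    rw [hskew, Matrix.transpose_neg, hskew])
  rw [congrDeriv_apply, hskew, Matrix.transpose_neg, hskew, neg_neg, mul_add, Matrix.trace_add,
    neg_mul, mul_neg, Matrix.trace_neg, ← Matrix.mul_assoc, ← Matrix.mul_assoc,
    Matrix.trace_mul_cycle X ⁅A, X⁆ A, Matrix.trace_mul_comm (X * A)] at h1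
  rw [hskew, mul_neg, Matrix.trace_neg]
  conv_lhs => arg 1; arg 1; arg 1; rw [Ring.lie_def]
  rw [sub_mul, Matrix.trace_sub, Matrix.trace_mul_comm (X * A)]
  linarith

/-- Testing with `K = (A * X)ᵀ` gives twice the sum of squares of the entries of `A * X`. -/
theorem mul_eq_zero_of_trace_eq_zero {A X : Matrix V V ℝ} (hA : A.IsSymm) (hX : X.IsSymm)
    (h : ∀ K, (X * congrDeriv A K).trace = 0) : A * X = 0 := by
  apply eq_zero_of_trace_mul_transpose
  have h1 := h (A * X)ᵀ
  rw [congrDeriv_apply, mul_add, Matrix.trace_add, Matrix.transpose_transpose] at h1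
  have h2 : (X * ((A * X)ᵀ * A)).trace = (A * X * (A * X)ᵀ).trace := by
    rw [← Matrix.mul_assoc, Matrix.trace_mul_comm, ← Matrix.mul_assoc]
  have h3 : (X * (A * (A * X))).trace = (A * X * (A * X)ᵀ).trace := by
    rw [Matrix.transpose_mul, hA.eq, hX.eq, ← Matrix.mul_assoc, Matrix.trace_mul_comm]
  linarith

/-- If `Φ A` is injective on the matrices supported on `H`, so is `Φ B` for `B` near `A`. -/
theorem eventually_forall_mem_eq_zero (H : SimpleGraph V)
    (Φ : Matrix V V ℝ →ₗ[ℝ] Matrix V V ℝ →ₗ[ℝ] Matrix V V ℝ) (A : Matrix V V ℝ)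
    (h : ∀ X ∈ graphMatricesClosedZero H, Φ A X = 0 → X = 0) :
    ∀ᶠ B in 𝓝 A, ∀ X ∈ graphMatricesClosedZero H, Φ B X = 0 → X = 0 := by
  have hiff : ∀ B, Function.Injective
      (LinearMap.lcomp ℝ (Matrix V V ℝ) (closedZeroSubmodule H).subtype (Φ B)) ↔
      ∀ X ∈ graphMatricesClosedZero H, Φ B X = 0 → X = 0 := by
    intro B
    rw [injective_iff_map_eq_zero]
    exact ⟨fun hi X hX h0 => congrArg Subtype.val (hi ⟨X, hX⟩ h0),
      fun hi X h0 => Subtype.ext (hi X X.2 h0)⟩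
  have hev := LinearMap.eventually_injective
    (LinearMap.lcomp ℝ (Matrix V V ℝ) (closedZeroSubmodule H).subtype ∘ₗ Φ) ((hiff A).2 h)
  exact hev.mono fun B hB => (hiff B).1 hB

theorem eventually_hasSSPWrt {A : Matrix V V ℝ} {H : SimpleGraph V} (h : HasSSPWrt A H) :
    ∀ᶠ B in 𝓝 A, HasSSPWrt B H := by
  refine eventually_forall_mem_eq_zero Hᶜ
    (LinearMap.mul ℝ (Matrix V V ℝ) - (LinearMap.mul ℝ (Matrix V V ℝ)).flip) A ?_
  simpa [HasSSPWrt, Ring.lie_def] using h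

theorem eventually_hasSAPWrt {A : Matrix V V ℝ} {H : SimpleGraph V} (h : HasSAPWrt A H) :
    ∀ᶠ B in 𝓝 A, HasSAPWrt B H :=
  eventually_forall_mem_eq_zero Hᶜ (LinearMap.mul ℝ (Matrix V V ℝ)) A h

theorem HasSSPWrt.hasSSP {A : Matrix V V ℝ} {H : SimpleGraph V} (h : HasSSPWrt A H)
    (hA : A ∈ graphMatrices H) : HasSSP A := fun X hX hAX hIX =>
  h X (mem_graphMatricesClosedZero_compl hA hX hAX hIX)

theorem HasSAPWrt.hasSAP {A : Matrix V V ℝ} {H : SimpleGraph V} (h : HasSAPWrt A H)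
    (hA : A ∈ graphMatrices H) : HasSAP A := fun X hX hAX hIX =>
  h X (mem_graphMatricesClosedZero_compl hA hX hAX hIX)

end Liberation

theorem lemma2p3 {V : Type*} [Fintype V] [DecidableEq V] (G : SimpleGraph V)
    (A : Matrix V V ℝ) (hA : A ∈ graphMatrices G) (β : Finset (Sym2 V)) :
    (IsSSPLiberationSet G A β →
      ∃ A' ∈ graphMatrices (addEdges G β), HasSSP A' ∧ matrixSpec A' = matrixSpec A) ∧
    (IsSAPLiberationSet G A β →
      ∃ A' ∈ graphMatrices (addEdges G β), HasSAP A' ∧ A'.rank = A.rank) := by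
  constructor
  · rintro ⟨hne, hG, hlib⟩
    have herase : ∀ e ∈ β, HasSSPWrt A (addEdges G (β.erase e)) := fun e he =>
      hlib _ (Finset.erase_ssubset he) (Finset.card_erase_add_one he)
    have hfull : HasSSPWrt A (addEdges G β) := by
      obtain ⟨e, he⟩ := hne
      exact fun X hX => herase e he X
        (graphMatricesClosedZero_compl_anti G (Finset.erase_subset e β) hX)
    obtain ⟨K, hK, hmem, hssp⟩ := exists_congr_mem_graphMatrices G A hA β hne hG (skewSubmodule V)
      (fun e he X hX h => herase e he X hX (lie_eq_zero_of_trace_eq_zero hA.1 hX.1 h))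
      (eventually_hasSSPWrt hfull)
    refine ⟨_, hmem, HasSSPWrt.hasSSP hssp hmem, ?_⟩
    -- For skew `K` the matrix `exp K` is orthogonal, so the congruence is a similarity.
    have hinv : (exp K)ᵀ = (exp K)⁻¹ := by
      rw [← Matrix.exp_transpose, show Kᵀ = -K from hK, Matrix.exp_neg]
    obtain ⟨u, hu⟩ := Matrix.isUnit_exp K
    rw [matrixSpec, matrixSpec, hinv, ← hu, Matrix.charpoly_units_conj]
  · rintro ⟨hne, hG, hlib⟩
    have herase : ∀ e ∈ β, HasSAPWrt A (addEdges G (β.erase e)) := fun e he =>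
      hlib _ (Finset.erase_ssubset he) (Finset.card_erase_add_one he)
    have hfull : HasSAPWrt A (addEdges G β) := by
      obtain ⟨e, he⟩ := hne
      exact fun X hX => herase e he X
        (graphMatricesClosedZero_compl_anti G (Finset.erase_subset e β) hX)
    obtain ⟨K, -, hmem, hsap⟩ := exists_congr_mem_graphMatrices G A hA β hne hG ⊤
      (fun e he X hX h => herase e he X hX
        (mul_eq_zero_of_trace_eq_zero hA.1 hX.1 fun K => h K trivial))
      (eventually_hasSAPWrt hfull)
    refine ⟨_, hmem, HasSAPWrt.hasSAP hsap hmem, ?_⟩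
    -- For arbitrary `K`, invertibility of `exp K` suffices to preserve rank.
    have hdet : IsUnit (exp K).det := (Matrix.isUnit_iff_isUnit_det _).1 (Matrix.isUnit_exp K)
    rw [Matrix.rank_mul_eq_left_of_isUnit_det _ _ (by rwa [Matrix.det_transpose]),
      Matrix.rank_mul_eq_right_of_isUnit_det _ _ hdet]
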